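/- Let $N \ge 2$ and $n \ge 0$ be integers, $\omega = \exp(\pi i/N)$, $P = \mathrm{diag}(1,\omega^2)$, and let $X$ be the Pauli $X$ matrix. For $(p|\mathbf{x}|\mathbf{z}) \in \mathbb{Z}_{2N}\times\mathbb{Z}_2^n\times\mathbb{Z}_N^n$ the XP operator of precision $N$ on $n$ qubits is $XP_N(p|\mathbf{x}|\mathbf{z}) = \omega^p\bigotimes_{i} X^{\mathbf{x}[i]}P^{\mathbf{z}[i]}$; it determines its phase component $p$, X component $\mathbf{x}$ and Z component $\mathbf{z}$, and it is diagonal if and only if $\mathbf{x}=\mathbf{0}$. For an ordered list $\mathbf{S} = (S_0,\dots,S_{m-1})$ of operators and $\mathbf{a}\in\mathbb{Z}^m$ write $\mathbf{S}^{\mathbf{a}} = S_0^{\mathbf{a}[0]}\cdots S_{m-1}^{\mathbf{a}[m-1]}$. A matrix over $\mathbb{Z}_M$ is in Howell form (zero rows omitted) if its rows are nonzero and in echelon form, each leading entry $a$ equals $\gcd(M,a)$, every entry above a leading entry $a$ is strictly less than $a$ (as integers in $\{0,\dots,M-1\}$), and for each $k$ every vector of the row span whose first $k$ entries are zero lies in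 the span of those rows whose first $k$ entries are zero. For any set $\mathbf{G}$ of XP operators of precision $N$ on $n$ qubits there exist a unique list $\mathbf{S}_Z$ of diagonal XP operators and a unique list $\mathbf{S}_X$ of non-diagonal XP operators (the canonical generators) such that $\langle \mathbf{S}_X,\mathbf{S}_Z\rangle = \langle\mathbf{G}\rangle$, $\mathbf{S}_Z$ generates the subgroup of diagonal operators in $\langle\mathbf{G}\rangle$, and: 1. the binary matrix whose rows are the X components of $\mathbf{S}_X$ is in reduced row echelon form; 2. the matrix $S_{Zp}$ over $\mathbb{Z}_{2N}$ with rows $(2\mathbf{z}|p)$ for $XP_N(p|\mathbf{0}|\mathbf{z})\in\mathbf{S}_Z$ is in Howell form; 3. for each $XP_N(p|\mathbf{x}|\mathbf{z})\in\mathbf{S}_X$, the matrix $\begin{pmatrix}1&(2\mathbf{z}|p)\\ \mathbf{0}&S_{Zp}\end{pmatrix}$ over $\mathbb{Z}_{2N}$ is in Howell form. The canonical generators have the following properties. Property 1: every $G\in\langle\mathbf{G}\rangle$ can be expressed as $G = \mathbf{S}_X^{\mathbf{a}}\mathbf{S}_Z^{\mathbf{b}}$ with $\mathbf{a}\in\{0,1\}^{|\mathbf{S}_X|}$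 and $\mathbf{b}\in\{0,\dots,2N-1\}^{|\mathbf{S}_Z|}$. Property 2: two sets of XP operators of precision $N$ on $n$ qubits generate the same group if and only if they have the same canonical generators. -/

import Mathlib

/-! ### Operators on `n` qubits -/

/-- Invertible operators on `n` qubits, as matrices in the computational basis; the basis vectors
are indexed by the binary strings `Fin n → Fin 2`. -/
abbrev QubitOp (n : ℕ) : Type := Matrix.GeneralLinearGroup (Fin n → Fin 2) ℂ

/-- The tensor (Kronecker) product `M₀ ⊗ ⋯ ⊗ Mₙ₋₁` of single-qubit matrices, whose `(e, f)` entry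
is `∏ i, Mᵢ (eᵢ, fᵢ)`; it is multiplicative in the tuple of factors. -/
def qubitTensorHom (n : ℕ) :
    (Fin n → Matrix (Fin 2) (Fin 2) ℂ) →* Matrix (Fin n → Fin 2) (Fin n → Fin 2) ℂ where
  toFun M := Matrix.of fun e f => ∏ i, M i (e i) (f i)
  map_one' := by
    ext e f
    simp only [Matrix.of_apply, Pi.one_apply, Matrix.one_apply, Finset.prod_ite_zero,
      Finset.prod_const_one, Finset.mem_univ, forall_true_left, funext_iff]
  map_mul' A B := by
    ext e f
    simp only [Matrix.of_apply, Pi.mul_apply, Matrix.mul_apply, Fintype.prod_sum,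
      Finset.prod_mul_distrib]

/-- The tensor product of invertible single-qubit operators. -/
def qubitTensor {n : ℕ} (A : Fin n → Matrix.GeneralLinearGroup (Fin 2) ℂ) : QubitOp n :=
  Units.map (qubitTensorHom n) (MulEquiv.piUnits.symm A)

/-! ### XP operators -/

/-- The phase `ω = exp (π i / N)`, as an invertible complex number. -/
noncomputable def xpOmega (N : ℕ) : ℂˣ :=
  Units.mk0 (Complex.exp (Real.pi * Complex.I / N)) (Complex.exp_ne_zero _)

/-- The single-qubit Pauli operator `X`. -/
def pauliX : Matrix.GeneralLinearGroup (Fin 2) ℂ where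
  val := !![0, 1; 1, 0]
  inv := !![0, 1; 1, 0]
  val_inv := by simp [Matrix.one_fin_two]
  inv_val := by simp [Matrix.one_fin_two]

/-- The single-qubit phase operator `P = diag (1, ω²)`. -/
noncomputable def phaseP (N : ℕ) : Matrix.GeneralLinearGroup (Fin 2) ℂ where
  val := !![1, 0; 0, ((xpOmega N ^ 2 : ℂˣ) : ℂ)]
  inv := !![1, 0; 0, (((xpOmega N ^ 2)⁻¹ : ℂˣ) : ℂ)]
  val_inv := by simp [Matrix.one_fin_two]
  inv_val := by simp [Matrix.one_fin_two]

/-- Vectors `(p | x | z)` in `ℤ_{2N} × ℤ₂ⁿ × ℤ_Nⁿ`. -/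
structure XPVector (N n : ℕ) where
  /-- the phase component -/
  p : ZMod (2 * N)
  /-- the X component -/
  x : Fin n → ZMod 2
  /-- the Z component -/
  z : Fin n → ZMod N

/-- The XP operator `XP_N(p | x | z) = ω^p ⨂ᵢ X^{xᵢ} P^{zᵢ}`. For `N ≥ 1` the vector is determined
by the operator. -/
noncomputable def XPVector.toOp {N n : ℕ} (u : XPVector N n) : QubitOp n :=
  xpOmega N ^ u.p.val • qubitTensor fun i => pauliX ^ (u.x i).val * phaseP N ^ (u.z i).val

/-- The vector `(2z | p)` of length `n + 1` over `ℤ_{2N}`, where `z ∈ ℤ_Nⁿ`. -/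
def XPVector.Zp {N n : ℕ} (u : XPVector N n) : Fin (n + 1) → ZMod (2 * N) :=
  Fin.snoc (α := fun _ => ZMod (2 * N)) (fun i => ((2 * (u.z i).val : ℕ) : ZMod (2 * N))) u.p

/-- The matrix whose rows are the X components of a list of XP operators. -/
def xMatrix {N n : ℕ} (A : List (XPVector N n)) : Matrix (Fin A.length) (Fin n) (ZMod 2) :=
  Matrix.of fun i => (A.get i).x

/-- The matrix whose rows are the vectors `(2z | p)` of a list of (diagonal) XP operators. -/
def zpMatrix {N n : ℕ} (B : List (XPVector N n)) :
    Matrix (Fin B.length) (Fin (n + 1)) (ZMod (2 * N)) :=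
  Matrix.of fun j => (B.get j).Zp

/-! ### Howell matrix form -/

/-- The minimal associate `gcd (M, a)` of an element `a` of `ℤ_M` (it is `0` for `a = 0`). -/
def minimalAssociate {M : ℕ} (a : ZMod M) : ZMod M := (Nat.gcd M a.val : ℕ)

/-- Howell matrix form over `ℤ_M`, with the zero rows left out: the rows are nonzero and in
echelon form, each leading entry is a minimal associate, the entries above a leading entry are
strictly smaller than it, and, for every `k`, each vector of the row span whose first `k` entries
vanish is in the span of those rows whose first `k` entries vanish (the Howell property). -/
structure IsHowellForm {M s m : ℕ} (H : Matrix (Fin s) (Fin m) (ZMod M)) : Prop where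
  row_ne_zero : ∀ i, H i ≠ 0
  isRowEchelon : H.IsRowEchelon
  leading : ∀ i c, H.IsLeadingEntry i c → H i c = minimalAssociate (H i c)
  reduced : ∀ i₁ i₂ c, i₁ < i₂ → H.IsLeadingEntry i₂ c → (H i₁ c).val < (H i₂ c).val
  howell : ∀ k : ℕ, ∀ v ∈ Submodule.span (ZMod M) (Set.range H.row),
    (∀ j : Fin m, j.val < k → v j = 0) →
      v ∈ Submodule.span (ZMod M) (H.row '' {i | ∀ j : Fin m, j.val < k → H i j = 0})

/-- The block matrix `(1 v; 0 H)`. -/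
def borderedMatrix {R : Type*} [Zero R] [One R] {s m : ℕ} (v : Fin m → R)
    (H : Matrix (Fin s) (Fin m) R) : Matrix (Fin (s + 1)) (Fin (m + 1)) R :=
  Matrix.of (Fin.cons (Fin.cons 1 v : Fin (m + 1) → R) fun i => (Fin.cons 0 (H i)))

/-! ### Canonical generators -/

/-- The canonical form of a list `A` of non-diagonal and a list `B` of diagonal XP operators. -/
structure IsCanonicalForm {N n : ℕ} (A B : List (XPVector N n)) : Prop where
  nondiagonal : ∀ u ∈ A, u.x ≠ 0
  diagonal : ∀ u ∈ B, u.x = 0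
  rref : (xMatrix A).IsReducedRowEchelon
  howell : IsHowellForm (zpMatrix B)
  reduced : ∀ u ∈ A, IsHowellForm (borderedMatrix u.Zp (zpMatrix B))

/-- `SX` (non-diagonal) and `SZ` (diagonal) are canonical generators, of precision `N`, of the
group `⟨G⟩`: they are in canonical form, together they generate `⟨G⟩`, and `SZ` generates the
subgroup of diagonal operators in `⟨G⟩`. -/
structure IsCanonicalGenerators (N : ℕ) {n : ℕ} (G : Set (QubitOp n)) (SX SZ : List (QubitOp n)) :
    Prop where
  form : ∃ A B : List (XPVector N n),
    SX = A.map XPVector.toOp ∧ SZ = B.map XPVector.toOp ∧ IsCanonicalForm A B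
  generates : Subgroup.closure ({g | g ∈ SX} ∪ {g | g ∈ SZ}) = Subgroup.closure G
  generates_diagonal : ∀ g : QubitOp n, g ∈ Subgroup.closure {h | h ∈ SZ} ↔
    g ∈ Subgroup.closure G ∧ (g : Matrix (Fin n → Fin 2) (Fin n → Fin 2) ℂ).IsDiag

/-- The ordered generator product `S^a = ∏ᵢ Sᵢ^{aᵢ}`. -/
def generatorProduct {Γ : Type*} [Group Γ] (S : List Γ) (a : Fin S.length → ℤ) : Γ :=
  (List.ofFn fun i => S.get i ^ a i).prod

/-! An XP operator is a monomial matrix: column `f` has its only nonzero entry in row `f + x`, and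
that entry is ω to the power p + Σ 2 zᵢ fᵢ. So the operator determines its vector, and the vectors
form a group embedded in the invertible matrices. The X component is a homomorphism to ℤ₂ⁿ, and
right multiplication by a diagonal operator adds the vectors (2z | p). A group Γ of XP operators is
therefore described by the binary space V of its X components (`xSpace`), the submodule L of
ℤ_{2N}^{n+1} of its diagonal operators (`diagonalLattice`), and, for each X component, a coset of L.

Each of these has a normal form. The Z generators are the Howell form of L. The X components of the
X generators are the reduced row echelon form of V, which over ℤ₂ is a Howell form too. An X
generator with given X component is fixed up to L, and the condition on the bordered matrix says
that its vector is the reduced representative modulo L (`isHowellForm_borderedMatrix_iff`).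

Existence and uniqueness thus come down to `exists_isHowellForm` and `IsHowellForm.unique` for
submodules, and to `exists_isReducedMod` and `IsReducedMod.eq_of_sub_mem` for cosets. All rest on
one fact: the entries at column c of the vectors of L that vanish before c form an ideal of ℤ_M,
generated by a divisor of M.

For Property 1, a product of X generators matches the X component of the element; the quotient is
diagonal, and its vector is a combination of the rows of the Howell form. Property 2 holds because
the normal forms depend on Γ alone and generate it. -/

/-! ### Division, reduction and Howell forms over ℤ_M -/

section HowellTheory

variable {M m : ℕ}

/-- The first nonzero entry of the vector `v` is at position `c`. -/
def LeadsAt (v : Fin m → ZMod M) (c : Fin m) : Prop :=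
  (∀ j < c, v j = 0) ∧ v c ≠ 0

/-- From column `k` on, the entries of `w` are strictly smaller than the minimal associates of all
leading entries, in the same column, of vectors of `L`. -/
def IsReducedMod (L : Submodule (ZMod M) (Fin m → ZMod M)) (k : ℕ) (w : Fin m → ZMod M) : Prop :=
  ∀ c : Fin m, k ≤ c.val → ∀ u ∈ L, LeadsAt u c → (w c).val < Nat.gcd M (u c).val

theorem exists_leadsAt {v : Fin m → ZMod M} (hv : v ≠ 0) : ∃ c, LeadsAt v c :=
  (Matrix.row_ne_zero_iff_exists_isLeadingEntry (A := Matrix.of fun _ : Unit => v) (i := ())).1 hv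

theorem LeadsAt.unique {v : Fin m → ZMod M} {c c' : Fin m} (h : LeadsAt v c) (h' : LeadsAt v c') :
    c = c' :=
  Matrix.IsLeadingEntry.unique (A := Matrix.of fun _ : Unit => v) (i := ()) h h'

variable [NeZero M]

/-- Zero is excluded because it equals its minimal associate, the class of M, although 0 does not
divide M. For nonzero `a` the gcd is below M, so casting it loses nothing. -/
theorem eq_minimalAssociate_iff {a : ZMod M} (ha : a ≠ 0) :
    a = minimalAssociate a ↔ a.val ∣ M := by
  have hlt : Nat.gcd M a.val < M := by
    refine lt_of_le_of_lt (Nat.gcd_le_right _ (Nat.pos_of_ne_zero ?_)) a.val_lt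
    simpa [ZMod.val_eq_zero] using ha
  have h2 : (minimalAssociate a).val = Nat.gcd M a.val := ZMod.val_cast_of_lt hlt
  constructor
  · intro h
    have := congrArg ZMod.val h
    rw [h2] at this
    rw [this]
    exact Nat.gcd_dvd_left _ _
  · intro h
    apply ZMod.val_injective
    rw [h2, Nat.gcd_eq_right h]

omit [NeZero M] in
theorem val_dvd_val_of_dvd {a b : ZMod M} (ha : a.val ∣ M) (h : a ∣ b) : a.val ∣ b.val := by
  obtain ⟨c, rfl⟩ := h
  rw [ZMod.val_mul]
  exact (Nat.dvd_mod_iff ha).2 (dvd_mul_right _ _)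

theorem dvd_of_val_dvd_val {a b : ZMod M} (h : a.val ∣ b.val) : a ∣ b := by
  obtain ⟨c, hc⟩ := h
  refine ⟨(c : ZMod M), ?_⟩
  rw [← ZMod.natCast_zmod_val b, hc, Nat.cast_mul, ZMod.natCast_zmod_val]

/-- Bézout's identity read modulo M. -/
theorem exists_mul_eq_minimalAssociate (a : ZMod M) :
    ∃ k : ZMod M, k * a = minimalAssociate a := by
  refine ⟨(Nat.gcdB M a.val : ℤ), ?_⟩
  have h := congrArg (Int.cast : ℤ → ZMod M) (Nat.gcd_eq_gcd_ab M a.val)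
  push_cast at h
  simp only [CharP.cast_eq_zero, zero_mul, zero_add, ZMod.natCast_zmod_val] at h
  rw [minimalAssociate, h, mul_comm]

/-- Division with remainder of the entry `w c` by the entry `u c`. -/
theorem exists_val_sub_smul_eq_mod (w : Fin m → ZMod M) {u : Fin m → ZMod M} {c : Fin m}
    (hpos : 0 < (u c).val) : ∃ q : ZMod M, ((w - q • u) c).val = (w c).val % (u c).val := by
  refine ⟨(((w c).val / (u c).val : ℕ) : ZMod M), ?_⟩
  have h1 := congrArg (Nat.cast : ℕ → ZMod M) (Nat.mod_add_div (w c).val (u c).val)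
  rw [Nat.cast_add, Nat.cast_mul, ZMod.natCast_zmod_val, ZMod.natCast_zmod_val] at h1
  have he : (w - (((w c).val / (u c).val : ℕ) : ZMod M) • u) c =
      (((w c).val % (u c).val : ℕ) : ZMod M) := by
    simp only [Pi.sub_apply, Pi.smul_apply, smul_eq_mul]
    rw [sub_eq_iff_eq_add, mul_comm]
    exact h1.symm
  rw [he]
  exact ZMod.val_cast_of_lt ((Nat.mod_lt _ hpos).trans (u c).val_lt)

/-- Among the vectors of `L` whose leading entry is at position `c` there is one whose leading
entry divides the entries at `c` of all vectors of `L` that vanish before `c`. -/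
theorem exists_minimal_leadsAt (L : Submodule (ZMod M) (Fin m → ZMod M)) (c : Fin m)
    (h : ∃ u ∈ L, LeadsAt u c) :
    ∃ u ∈ L, LeadsAt u c ∧ (u c).val ∣ M ∧
      ∀ w ∈ L, (∀ j < c, w j = 0) → (u c).val ∣ (w c).val := by
  classical
  have hex : ∃ a : ℕ, ∃ u ∈ L, LeadsAt u c ∧ (u c).val = a := by
    obtain ⟨u, hu, hc⟩ := h
    exact ⟨_, u, hu, hc, rfl⟩
  obtain ⟨u, hu, hc, hval⟩ := Nat.find_spec hex
  have hmin : ∀ w ∈ L, LeadsAt w c → (u c).val ≤ (w c).val := fun w hw hwc => by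
    rw [hval]
    exact Nat.find_min' hex ⟨w, hw, hwc, rfl⟩
  have hpos : 0 < (u c).val := Nat.pos_of_ne_zero (by simpa [ZMod.val_eq_zero] using hc.2)
  refine ⟨u, hu, hc, ?_, fun w hw hw0 => ?_⟩
  -- A multiple of `u` has leading entry `gcd M (u c)`, so minimality forces `u c` to be that gcd.
  · obtain ⟨k, hk⟩ := exists_mul_eq_minimalAssociate (u c)
    have hle : Nat.gcd M (u c).val ≤ (u c).val := Nat.gcd_le_right _ hpos
    have hv : (minimalAssociate (u c)).val = Nat.gcd M (u c).val :=
      ZMod.val_cast_of_lt (hle.trans_lt (u c).val_lt)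
    have h1 := hmin (k • u) (L.smul_mem _ hu) ⟨fun j hj => by simp [hc.1 j hj], fun h0 => by
      have h0' : k * u c = 0 := h0
      rw [hk] at h0'
      rw [h0', ZMod.val_zero] at hv
      exact absurd hv.symm (Nat.gcd_pos_of_pos_right _ hpos).ne'⟩
    have h2 : ((k • u) c).val = Nat.gcd M (u c).val := by
      rw [← hv, ← hk]; rfl
    rw [h2] at h1
    rw [← le_antisymm hle h1]
    exact Nat.gcd_dvd_left _ _
  -- Otherwise the remainder of `w` on division by `u` would lead at `c` with a smaller entry.
  · by_contra hnd
    have hr : 0 < (w c).val % (u c).val :=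
      Nat.pos_of_ne_zero fun h0 => hnd (Nat.dvd_of_mod_eq_zero h0)
    have hlt := Nat.mod_lt (w c).val hpos
    obtain ⟨q, hv⟩ := exists_val_sub_smul_eq_mod w hpos
    have h1 := hmin (w - q • u) (L.sub_mem hw (L.smul_mem _ hu))
      ⟨fun j hj => by simp [hc.1 j hj, hw0 j hj], fun h0 => by
        rw [h0, ZMod.val_zero] at hv
        omega⟩
    omega

/-- Vectors have at most one reduced representative modulo `L`. -/
theorem IsReducedMod.eq_of_sub_mem {L : Submodule (ZMod M) (Fin m → ZMod M)} {k : ℕ}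
    {w w' : Fin m → ZMod M} (h : IsReducedMod L k w) (h' : IsReducedMod L k w')
    (hL : w - w' ∈ L) (h0 : ∀ j : Fin m, j.val < k → w j = w' j) : w = w' := by
  by_contra hne
  obtain ⟨c, hc⟩ := exists_leadsAt (sub_ne_zero.2 hne)
  have hkc : k ≤ c.val := by
    by_contra hlt
    exact hc.2 (by simp [h0 c (by omega)])
  -- At the first column where they differ, the two entries are congruent modulo the minimal leading
  -- entry `u c`, and both are smaller than it.
  obtain ⟨u, hu, huc, huM, hdiv⟩ := exists_minimal_leadsAt L c ⟨_, hL, hc⟩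
  have h1 := h c hkc u hu huc
  have h2 := h' c hkc u hu huc
  rw [Nat.gcd_eq_right huM] at h1 h2
  have h3 : u c ∣ w c - w' c := dvd_of_val_dvd_val (hdiv _ hL hc.1)
  obtain ⟨q, hq⟩ := h3
  have h4 : (w c).val ≡ (w' c).val [MOD (u c).val] := by
    have h5 : w c = w' c + u c * q := by rw [← hq]; ring
    rw [h5, ZMod.val_add, ZMod.val_mul, Nat.add_mod_mod]
    unfold Nat.ModEq
    rw [Nat.mod_mod_of_dvd _ huM, Nat.add_mul_mod_self_left]
  have h6 : (w c).val = (w' c).val := Nat.ModEq.eq_of_lt_of_lt h4 h1 h2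
  exact hc.2 (by simp [ZMod.val_injective M h6])

/-- Vectors have a representative modulo `L` that is reduced from column `k` on, and that agrees
with them before. -/
theorem exists_isReducedMod (L : Submodule (ZMod M) (Fin m → ZMod M)) (k : ℕ)
    (w : Fin m → ZMod M) :
    ∃ w', w' - w ∈ L ∧ (∀ j : Fin m, j.val < k → w' j = w j) ∧ IsReducedMod L k w' := by
  rcases le_total k m with hk | hk
  swap
  · exact ⟨w, by simp, fun _ _ => rfl, fun c hc => by omega⟩
  induction hk using Nat.decreasingInduction generalizing w with
  | self => exact ⟨w, by simp, fun _ _ => rfl, fun c hc => by omega⟩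
  | of_succ k hk ih =>
    by_cases hpiv : ∃ u ∈ L, LeadsAt u (⟨k, hk⟩ : Fin m)
    · obtain ⟨u, hu, huc, huM, hdiv⟩ := exists_minimal_leadsAt L ⟨k, hk⟩ hpiv
      set c : Fin m := ⟨k, hk⟩ with hcdef
      have hpos : 0 < (u c).val := Nat.pos_of_ne_zero (by simpa [ZMod.val_eq_zero] using huc.2)
      have hlt := Nat.mod_lt (w c).val hpos
      obtain ⟨q, hv⟩ := exists_val_sub_smul_eq_mod w hpos
      -- Subtracting `q • u` settles column `k` and disturbs only columns from `k` on; the later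
      -- reductions leave the columns up to `k` alone.
      obtain ⟨w', hw', heq, hred⟩ := ih (w - q • u)
      refine ⟨w', ?_, fun j hj => ?_, fun c' hc' v hv' hvc => ?_⟩
      · have : w' - w = (w' - (w - q • u)) - q • u := by abel
        rw [this]
        exact L.sub_mem hw' (L.smul_mem _ hu)
      · rw [heq j (by omega)]
        have hjc : j < c := hj
        simp [huc.1 j hjc]
      · rcases hc'.eq_or_lt with h | h
        · have : c' = c := Fin.ext h.symm
          rw [this] at hvc ⊢
          rw [heq c (Nat.lt_succ_self k), hv]
          refine hlt.trans_le (Nat.le_of_dvd (Nat.gcd_pos_of_pos_left _ (NeZero.pos M)) ?_)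
          exact Nat.dvd_gcd huM (hdiv v hv' hvc.1)
        · exact hred c' h v hv' hvc
    · obtain ⟨w', hw', heq, hred⟩ := ih w
      refine ⟨w', hw', fun j hj => heq j (by omega), fun c' hc' v hv' hvc => ?_⟩
      rcases hc'.eq_or_lt with h | h
      · have : c' = ⟨k, hk⟩ := Fin.ext h.symm
        subst this
        exact absurd ⟨v, hv', hvc⟩ hpiv
      · exact hred c' h v hv' hvc

/-! ### Pivots and uniqueness of Howell forms -/

section HowellForm

variable {s : ℕ} {H : Matrix (Fin s) (Fin m) (ZMod M)}

theorem IsHowellForm.val_dvd (hH : IsHowellForm H) {i : Fin s} {c : Fin m}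
    (hc : LeadsAt (H i) c) : (H i c).val ∣ M :=
  (eq_minimalAssociate_iff hc.2).1 (hH.leading i c hc)

omit [NeZero M] in
-- By the Howell property `u` is a combination of rows vanishing before `c`; if none of them led at
-- `c`, all would vanish there, and so would `u`. Hence the pivot columns depend only on the row
-- span.
theorem IsHowellForm.exists_leadsAt_row (hH : IsHowellForm H) {u : Fin m → ZMod M}
    (hu : u ∈ Submodule.span (ZMod M) (Set.range H.row)) {c : Fin m} (hc : LeadsAt u c) :
    ∃ i, LeadsAt (H i) c := by
  by_contra! hno
  refine hc.2 ?_
  have hle : Submodule.span (ZMod M) (H.row '' {i | ∀ j : Fin m, j.val < c.val → H i j = 0}) ≤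
      LinearMap.ker (LinearMap.proj (R := ZMod M) (φ := fun _ : Fin m => ZMod M) c) := by
    rw [Submodule.span_le]
    rintro _ ⟨i, hi, rfl⟩
    by_contra hne
    exact hno i ⟨fun j hj => hi j hj, hne⟩
  exact hle (hH.howell c.val u hu fun j hj => hc.1 j hj)

/-- Among the rows vanishing before `c`, only row `i` is nonzero at `c`: lower rows vanish there by
the echelon form, and a higher such row would force row `i` to vanish there. -/
theorem IsHowellForm.dvd_of_leadsAt (hH : IsHowellForm H) {i : Fin s} {c : Fin m}
    (hi : LeadsAt (H i) c) {u : Fin m → ZMod M}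
    (hu : u ∈ Submodule.span (ZMod M) (Set.range H.row)) (hc : ∀ j < c, u j = 0) :
    (H i c).val ∣ (u c).val := by
  have hle : Submodule.span (ZMod M) (H.row '' {i | ∀ j : Fin m, j.val < c.val → H i j = 0}) ≤
      Submodule.comap (LinearMap.proj (R := ZMod M) (φ := fun _ : Fin m => ZMod M) c)
        (Ideal.span {H i c}) := by
    rw [Submodule.span_le]
    rintro _ ⟨j, hj, rfl⟩
    change H j c ∈ Ideal.span {H i c}
    rcases lt_trichotomy i j with h | rfl | h
    · rw [hH.isRowEchelon h hi.1]
      exact zero_mem _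
    · exact Ideal.mem_span_singleton_self _
    · exact absurd (hH.isRowEchelon h fun j' hj' => hj j' hj') hi.2
  have := hle (hH.howell c.val u hu fun j hj => hc j hj)
  exact val_dvd_val_of_dvd (hH.val_dvd hi) (Ideal.mem_span_singleton.1 this)

theorem IsHowellForm.isReducedMod (hH : IsHowellForm H) {w : Fin m → ZMod M} {k : ℕ}
    (hw : ∀ i c, k ≤ c.val → LeadsAt (H i) c → (w c).val < (H i c).val) :
    IsReducedMod (Submodule.span (ZMod M) (Set.range H.row)) k w := by
  intro c hk u hu hc
  obtain ⟨i, hi⟩ := hH.exists_leadsAt_row hu hc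
  exact (hw i c hk hi).trans_le (Nat.le_of_dvd (Nat.gcd_pos_of_pos_left _ (NeZero.pos M))
    (Nat.dvd_gcd (hH.val_dvd hi) (hH.dvd_of_leadsAt hi hu hc.1)))

omit [NeZero M] in
theorem Matrix.IsRowEchelon.lt_of_leadsAt (hH : H.IsRowEchelon) {i i' : Fin s} {c c' : Fin m}
    (hc : LeadsAt (H i) c) (hc' : LeadsAt (H i') c') (hlt : i < i') : c < c' := by
  by_contra! hle
  exact hc'.2 (hH hlt fun j hj => hc.1 j (hj.trans_le hle))

/-- The range starts one past the pivot, since the leading entry is not smaller than itself. -/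
theorem IsHowellForm.isReducedMod_row (hH : IsHowellForm H) {i : Fin s} {c : Fin m}
    (hc : LeadsAt (H i) c) :
    IsReducedMod (Submodule.span (ZMod M) (Set.range H.row)) (c.val + 1) (H i) := by
  refine hH.isReducedMod fun i' c' hk hc' => hH.reduced i i' c' ?_ hc'
  rcases lt_trichotomy i i' with h | rfl | h
  · exact h
  · have := hc.unique hc'
    omega
  · have := hH.isRowEchelon.lt_of_leadsAt hc' hc h
    omega

omit [NeZero M] in
theorem IsHowellForm.row_mem (i : Fin s) :
    H i ∈ Submodule.span (ZMod M) (Set.range H.row) :=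
  Submodule.subset_span ⟨i, rfl⟩

/-- The Howell form of a submodule is unique. -/
theorem IsHowellForm.unique {s' : ℕ} {H' : Matrix (Fin s') (Fin m) (ZMod M)}
    (hH : IsHowellForm H) (hH' : IsHowellForm H')
    (hspan : Submodule.span (ZMod M) (Set.range H.row) =
      Submodule.span (ZMod M) (Set.range H'.row)) :
    ∃ h : s = s', ∀ i, H i = H' (Fin.cast h i) := by
  choose p hp using fun i => exists_leadsAt (hH.row_ne_zero i)
  choose p' hp' using fun i => exists_leadsAt (hH'.row_ne_zero i)
  have hmono : StrictMono p := fun i j h => hH.isRowEchelon.lt_of_leadsAt (hp i) (hp j) h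
  have hmono' : StrictMono p' := fun i j h => hH'.isRowEchelon.lt_of_leadsAt (hp' i) (hp' j) h
  have hrange : Set.range p = Set.range p' := by
    ext c
    constructor
    · rintro ⟨i, rfl⟩
      obtain ⟨i', hi'⟩ := hH'.exists_leadsAt_row (hspan ▸ IsHowellForm.row_mem i) (hp i)
      exact ⟨i', (hp' i').unique hi'⟩
    · rintro ⟨i, rfl⟩
      obtain ⟨i', hi'⟩ := hH.exists_leadsAt_row (hspan ▸ IsHowellForm.row_mem i) (hp' i)
      exact ⟨i', (hp i').unique hi'⟩
  have hs : s = s' := by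
    have h1 := Set.card_range_of_injective hmono.injective
    have h2 := Set.card_range_of_injective hmono'.injective
    simp only [Fintype.card_fin] at h1 h2
    rw [← h1, ← h2]
    simp only [hrange]
  subst hs
  refine ⟨rfl, fun i => ?_⟩
  have hpp : p = p' := by
    have := (StrictMono.range_inj hmono hmono').1 hrange
    exact this
  change H i = H' i
  have hc := hp i
  have hc' := hp' i
  rw [← hpp] at hc'
  have hmem' : H' i ∈ Submodule.span (ZMod M) (Set.range H.row) :=
    hspan ▸ IsHowellForm.row_mem i
  -- The two rows share their pivot, where their entries divide each other; beyond it both are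
  -- reduced modulo the common span.
  refine (hH.isReducedMod_row hc).eq_of_sub_mem (hspan ▸ hH'.isReducedMod_row hc')
    (Submodule.sub_mem _ (IsHowellForm.row_mem i) hmem') fun j hj => ?_
  rcases (Nat.lt_succ_iff.1 hj).eq_or_lt with h | h
  · have : j = p i := Fin.ext h
    subst this
    refine ZMod.val_injective M (Nat.dvd_antisymm ?_ ?_)
    · exact hH.dvd_of_leadsAt hc hmem' hc'.1
    · exact hH'.dvd_of_leadsAt hc' (hspan ▸ IsHowellForm.row_mem i) hc.1
  · rw [hc.1 j h, hc'.1 j h]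

end HowellForm

/-- Every submodule is the row span of a matrix in Howell form. -/
theorem exists_isHowellForm (L : Submodule (ZMod M) (Fin m → ZMod M)) :
    ∃ (s : ℕ) (H : Matrix (Fin s) (Fin m) (ZMod M)),
      IsHowellForm H ∧ Submodule.span (ZMod M) (Set.range H.row) = L := by
  classical
  have hrow : ∀ c, (∃ u ∈ L, LeadsAt u c) → ∃ r ∈ L, LeadsAt r c ∧ (r c).val ∣ M ∧
      (∀ w ∈ L, (∀ j < c, w j = 0) → (r c).val ∣ (w c).val) ∧
      IsReducedMod L (c.val + 1) r := by
    intro c h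
    obtain ⟨u, hu, huc, huM, hdiv⟩ := exists_minimal_leadsAt L c h
    obtain ⟨r, hr, heq, hred⟩ := exists_isReducedMod L (c.val + 1) u
    have hrc : r c = u c := heq c (by omega)
    refine ⟨r, ?_, ⟨fun j hj => ?_, ?_⟩, ?_, ?_, hred⟩
    · simpa using L.add_mem hr hu
    · rw [heq j (by omega), huc.1 j hj]
    · rw [hrc]; exact huc.2
    · rw [hrc]; exact huM
    · rw [hrc]; exact hdiv
  choose! r hrL hrc hrM hrdiv hrred using hrow
  set C : Finset (Fin m) := Finset.univ.filter fun c => ∃ u ∈ L, LeadsAt u c with hC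
  have hmemC : ∀ c, c ∈ C ↔ ∃ u ∈ L, LeadsAt u c := fun c => by simp [hC]
  set e := C.orderEmbOfFin rfl with he
  have heC : ∀ i, ∃ u ∈ L, LeadsAt u (e i) := fun i =>
    (hmemC _).1 (Finset.orderEmbOfFin_mem C rfl i)
  have hsurj : ∀ c, (∃ u ∈ L, LeadsAt u c) → ∃ i, e i = c := fun c hc => by
    have : c ∈ Set.range e := by
      rw [he, Finset.range_orderEmbOfFin]
      exact (hmemC c).2 hc
    exact this
  set H : Matrix (Fin C.card) (Fin m) (ZMod M) := Matrix.of fun i => r (e i) with hHdef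
  have hHi : ∀ i, H i = r (e i) := fun i => rfl
  have hlead : ∀ i, LeadsAt (H i) (e i) := fun i => hrc _ (heC i)
  have hspan : ∀ k : ℕ, ∀ v ∈ L, (∀ j : Fin m, j.val < k → v j = 0) →
      v ∈ Submodule.span (ZMod M) (H.row '' {i | ∀ j : Fin m, j.val < k → H i j = 0}) := by
    intro k
    rcases le_total k m with hk | hk
    swap
    · intro v _ h0
      have : v = 0 := funext fun j => h0 j (by omega)
      rw [this]
      exact zero_mem _
    induction hk using Nat.decreasingInduction with
    | self =>
      intro v _ h0
      have : v = 0 := funext fun j => h0 j (by omega)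
      rw [this]
      exact zero_mem _
    | of_succ k hk ih =>
      intro v hv h0
      have hmono : Submodule.span (ZMod M)
          (H.row '' {i | ∀ j : Fin m, j.val < k + 1 → H i j = 0}) ≤
          Submodule.span (ZMod M) (H.row '' {i | ∀ j : Fin m, j.val < k → H i j = 0}) :=
        Submodule.span_mono (Set.image_mono fun i hi j hj => hi j (by omega))
      by_cases hvk : v ⟨k, hk⟩ = 0
      · refine hmono (ih v hv fun j hj => ?_)
        rcases (Nat.lt_succ_iff.1 hj).eq_or_lt with h | h
        · rw [← hvk]; congr 1; exact Fin.ext h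
        · exact h0 j h
      · have hvl : LeadsAt v ⟨k, hk⟩ := ⟨fun j hj => h0 j hj, hvk⟩
        obtain ⟨i, hi⟩ := hsurj _ ⟨v, hv, hvl⟩
        have hdv : H i ⟨k, hk⟩ ∣ v ⟨k, hk⟩ := by
          have := hrdiv (e i) (heC i) v hv (by rw [hi]; exact hvl.1)
          rw [hi] at this
          rw [hHi, hi]
          exact dvd_of_val_dvd_val this
        obtain ⟨q, hq⟩ := hdv
        have hli := hlead i
        rw [hi] at hli
        -- Clearing the entry at column `k` with the pivot row leaves a vector covered by the case
        -- `k + 1`.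
        have h1 : v - q • H i ∈ Submodule.span (ZMod M)
            (H.row '' {i | ∀ j : Fin m, j.val < k + 1 → H i j = 0}) := by
          refine ih _ (L.sub_mem hv (L.smul_mem _ (hrL _ (heC i)))) fun j hj => ?_
          rcases (Nat.lt_succ_iff.1 hj).eq_or_lt with h | h
          · have : j = ⟨k, hk⟩ := Fin.ext h
            subst this
            simp [hq, mul_comm]
          · simp [h0 j h, hli.1 j h]
        have h2 : H i ∈ Submodule.span (ZMod M)
            (H.row '' {i | ∀ j : Fin m, j.val < k → H i j = 0}) :=
          Submodule.subset_span ⟨i, fun j hj => hli.1 j hj, rfl⟩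
        have := Submodule.add_mem _ (hmono h1) (Submodule.smul_mem _ q h2)
        simpa using this
  have hle : Submodule.span (ZMod M) (Set.range H.row) ≤ L := by
    rw [Submodule.span_le]
    rintro _ ⟨i, rfl⟩
    exact hrL _ (heC i)
  refine ⟨C.card, H, ⟨fun i h => (hlead i).2 (congrFun h _), ?_, ?_, ?_, ?_⟩,
    le_antisymm hle fun v hv => ?_⟩
  · intro i₁ i₂ hlt j hj
    have h12 : e i₁ < e i₂ := e.strictMono hlt
    refine (hlead i₂).1 j (lt_of_le_of_lt ?_ h12)
    by_contra! hj'
    exact (hlead i₁).2 (hj _ hj')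
  · intro i c hc
    have : c = e i := LeadsAt.unique hc (hlead i)
    subst this
    exact (eq_minimalAssociate_iff (hlead i).2).2 (hrM _ (heC i))
  · intro i₁ i₂ c hlt hc
    have : c = e i₂ := LeadsAt.unique hc (hlead i₂)
    subst this
    have h12 : e i₁ < e i₂ := e.strictMono hlt
    have := hrred _ (heC i₁) (e i₂) h12 _ (hrL _ (heC i₂)) (hlead i₂)
    rwa [Nat.gcd_eq_right (hrM _ (heC i₂))] at this
  · exact fun k v hv h0 => hspan k v (hle hv) h0
  · refine Submodule.span_mono ?_ (hspan 0 v hv (by simp))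
    exact Set.image_subset_range _ _

/-- The matrix `(1 w; 0 H)` is in Howell form iff `H` is and `w` is reduced modulo the row span
of `H`. -/
theorem isHowellForm_borderedMatrix_iff [Nontrivial (ZMod M)] {s : ℕ}
    {H : Matrix (Fin s) (Fin m) (ZMod M)} (hH : IsHowellForm H) (w : Fin m → ZMod M) :
    IsHowellForm (borderedMatrix w H) ↔
      IsReducedMod (Submodule.span (ZMod M) (Set.range H.row)) 0 w := by
  have b00 : borderedMatrix w H 0 0 = 1 := rfl
  have b0s : ∀ j : Fin m, borderedMatrix w H 0 j.succ = w j := fun _ => rfl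
  have bs0 : ∀ i : Fin s, borderedMatrix w H i.succ 0 = 0 := fun _ => rfl
  have bss : ∀ (i : Fin s) (j : Fin m), borderedMatrix w H i.succ j.succ = H i j :=
    fun _ _ => rfl
  have hl : ∀ (i : Fin s) (c : Fin m),
      (borderedMatrix w H).IsLeadingEntry i.succ c.succ ↔ LeadsAt (H i) c := by
    intro i c
    refine and_congr ?_ Iff.rfl
    rw [Fin.forall_fin_succ]
    simp [bs0, bss]
  have hl0 : ∀ i : Fin s, ¬ (borderedMatrix w H).IsLeadingEntry i.succ 0 := fun i h => h.2 (bs0 i)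
  have hl1 : ∀ c : Fin m, ¬ (borderedMatrix w H).IsLeadingEntry 0 c.succ := fun c h => by
    have := h.1 0 c.succ_pos
    rw [b00] at this
    exact one_ne_zero this
  constructor
  · intro hB
    refine hH.isReducedMod fun i c _ hc => ?_
    exact hB.reduced 0 i.succ c.succ i.succ_pos ((hl i c).2 hc)
  · intro hw
    refine ⟨?_, ?_, ?_, ?_, ?_⟩
    · intro i
      refine Fin.cases ?_ (fun i => ?_) i
      · exact fun h => one_ne_zero (congrFun h 0)
      · exact fun h => hH.row_ne_zero i (funext fun j => congrFun h j.succ)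
    · intro i₁ i₂
      refine Fin.cases ?_ (fun i₁ => ?_) i₁
      · refine Fin.cases ?_ (fun i₂ => ?_) i₂
        · intro h; exact absurd h (lt_irrefl _)
        · intro _ j₂
          refine Fin.cases (fun _ => rfl) (fun j₂ h => ?_) j₂
          exact absurd (h 0 j₂.succ_pos) (by rw [b00]; exact one_ne_zero)
      · refine Fin.cases ?_ (fun i₂ => ?_) i₂
        · intro h; exact absurd h (Fin.not_lt_zero _)
        · intro hlt j₂
          refine Fin.cases (fun _ => rfl) (fun j₂ h => ?_) j₂
          exact hH.isRowEchelon (Fin.succ_lt_succ_iff.1 hlt) fun j₁ hj =>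
            h j₁.succ (Fin.succ_lt_succ_iff.2 hj)
    · intro i c
      refine Fin.cases ?_ (fun i => ?_) i
      · refine Fin.cases ?_ (fun c hc => absurd hc (hl1 c)) c
        intro _
        rw [b00, minimalAssociate, ZMod.val_one'' (fun h => ?_), Nat.gcd_one_right, Nat.cast_one]
        subst h
        exact not_subsingleton (ZMod 1) inferInstance
      · refine Fin.cases (fun hc => absurd hc (hl0 i)) (fun c hc => ?_) c
        exact hH.leading i c ((hl i c).1 hc)
    · intro i₁ i₂ c hlt
      obtain ⟨i₂, rfl⟩ := Fin.exists_succ_eq.2 (Fin.ne_zero_of_lt hlt)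
      refine Fin.cases (fun hc => absurd hc (hl0 i₂)) (fun c hc => ?_) c
      rw [hl] at hc
      rw [bss]
      revert hlt
      refine Fin.cases (fun _ => ?_) (fun i₁ hlt => ?_) i₁
      · have := hw c (Nat.zero_le _) _ (IsHowellForm.row_mem i₂) hc
        rwa [Nat.gcd_eq_right (hH.val_dvd hc)] at this
      · exact hH.reduced i₁ i₂ c (Fin.succ_lt_succ_iff.1 hlt) hc
    · intro k v hv h0
      rcases k with _ | k
      · convert hv using 2
        ext x
        simp
      -- A vector of the span is a multiple of the top row plus `T` of a vector in the span of `H`.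
      -- The multiple is its entry at column 0, which vanishes, so the Howell property of `H`
      -- applies with `k` lowered by one.
      let T : (Fin m → ZMod M) →ₗ[ZMod M] (Fin (m + 1) → ZMod M) :=
        { toFun := fun u => Fin.cons 0 u
          map_add' := fun a b => by
            ext j; refine Fin.cases ?_ (fun j => ?_) j <;> simp
          map_smul' := fun a b => by
            ext j; refine Fin.cases ?_ (fun j => ?_) j <;> simp }
      have hTrow : ∀ i, T (H i) = borderedMatrix w H i.succ := fun i => rfl
      have hdec : ∃ a : ZMod M, ∃ u ∈ Submodule.span (ZMod M) (Set.range H.row),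
          v = a • borderedMatrix w H 0 + T u := by
        refine Submodule.span_induction ?_ ?_ ?_ ?_ hv
        · rintro _ ⟨i, rfl⟩
          refine Fin.cases ?_ (fun i => ?_) i
          · exact ⟨1, 0, zero_mem _, by simp; rfl⟩
          · exact ⟨0, H i, IsHowellForm.row_mem i, by simp [hTrow]; rfl⟩
        · exact ⟨0, 0, zero_mem _, by simp⟩
        · rintro _ _ _ _ ⟨a, u, hu, rfl⟩ ⟨b, u', hu', rfl⟩
          exact ⟨a + b, u + u', add_mem hu hu', by rw [map_add, add_smul]; abel⟩
        · rintro t _ _ ⟨a, u, hu, rfl⟩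
          exact ⟨t * a, t • u, Submodule.smul_mem _ _ hu, by rw [map_smul, smul_add, mul_smul]⟩
      obtain ⟨a, u, hu, rfl⟩ := hdec
      have ha : a = 0 := by
        have := h0 0 (Nat.succ_pos k)
        simpa [T, b00] using this
      subst ha
      rw [zero_smul, zero_add] at h0 ⊢
      have hu' := hH.howell k u hu fun j hj => h0 j.succ (by simpa using hj)
      have := Submodule.mem_map_of_mem (f := T) hu'
      rw [Submodule.map_span] at this
      refine Submodule.span_mono ?_ this
      rintro _ ⟨_, ⟨i, hi, rfl⟩, rfl⟩
      refine ⟨i.succ, fun j => ?_, rfl⟩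
      refine Fin.cases (fun _ => rfl) (fun j hj => ?_) j
      exact hi j (by simpa using hj)

end HowellTheory

/-! ### Howell form over ℤ₂ is reduced row echelon form -/

section BinaryHowell

variable {s m : ℕ} {H : Matrix (Fin s) (Fin m) (ZMod 2)}

theorem ZMod.two_eq_one_of_ne_zero {a : ZMod 2} (ha : a ≠ 0) : a = 1 := by
  revert a; decide

/-- Over `ℤ₂`, the reduced row echelon form without zero rows is the Howell form. -/
theorem Matrix.IsReducedRowEchelon.isHowellForm (h : H.IsReducedRowEchelon)
    (h0 : ∀ i, H i ≠ 0) : IsHowellForm H where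
  row_ne_zero := h0
  isRowEchelon := h.isRowEchelon
  leading i c hc := by rw [h.eq_one hc]; rfl
  reduced i₁ i₂ c hlt hc := by rw [h.eq_one hc, h.eq_zero hlt hc]; decide
  howell k v hv hv0 := by
    choose p hp using fun i => exists_leadsAt (h0 i)
    obtain ⟨c, rfl⟩ := (Submodule.mem_span_range_iff_exists_fun _).1 hv
    refine Submodule.sum_mem _ fun i _ => ?_
    -- Pivot columns are unit vectors, so the coefficient of row `i` is the entry of the combination
    -- at `p i`, which is zero when `p i` lies before `k`.
    by_cases hik : (p i).val < k
    · have hci := hv0 (p i) hik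
      have hsum : (∑ j, c j • H.row j) (p i) = c i := by
        rw [Finset.sum_apply, Finset.sum_eq_single i]
        · change c i * H i (p i) = c i
          rw [h.eq_one (hp i), mul_one]
        · intro j _ hj
          change c j * H j (p i) = 0
          rw [h.eq_zero_of_ne_of_isLeadingEntry hj (hp i), mul_zero]
        · simp
      rw [← hsum, hci, zero_smul]
      exact zero_mem _
    · exact Submodule.smul_mem _ _ (Submodule.subset_span
        ⟨i, fun j hj => (hp i).1 j (by omega), rfl⟩)

theorem IsHowellForm.isReducedRowEchelon (h : IsHowellForm H) : H.IsReducedRowEchelon where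
  isRowEchelon := h.isRowEchelon
  eq_one _ _ hc := ZMod.two_eq_one_of_ne_zero hc.2
  eq_zero i₁ i₂ c hlt hc := by
    have := h.reduced i₁ i₂ c hlt hc
    rw [ZMod.two_eq_one_of_ne_zero hc.2, ZMod.val_one, Nat.lt_one_iff] at this
    exact (ZMod.val_eq_zero _).1 this

end BinaryHowell

/-! ### Arithmetic of phases -/

section PhaseArithmetic

variable {N : ℕ}

/-- Doubling, as a homomorphism `ℤ_N → ℤ_{2N}`. -/
def doubleHom (N : ℕ) [NeZero N] : ZMod N →+ ZMod (2 * N) where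
  toFun z := ((2 * z.val : ℕ) : ZMod (2 * N))
  map_zero' := by simp
  map_add' a b := by
    rw [← Nat.cast_add, ← mul_add, ZMod.natCast_eq_natCast_iff, ZMod.val_add]
    exact (Nat.mod_modEq _ _).mul_left' 2

theorem val_doubleHom [NeZero N] (z : ZMod N) : (doubleHom N z).val = 2 * z.val :=
  ZMod.val_cast_of_lt (by have := z.val_lt; omega)

theorem doubleHom_injective [NeZero N] : Function.Injective (doubleHom N) := fun a b h => by
  have := congrArg ZMod.val h
  rw [val_doubleHom, val_doubleHom] at this
  exact ZMod.val_injective N (by omega)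

theorem isPrimitiveRoot_xpOmega (N : ℕ) [NeZero N] : IsPrimitiveRoot (xpOmega N) (2 * N) := by
  rw [← IsPrimitiveRoot.coe_units_iff]
  have h := Complex.isPrimitiveRoot_exp (2 * N) (NeZero.ne _)
  convert h using 1
  rw [xpOmega, Units.val_mk0]
  congr 1
  have : (N : ℂ) ≠ 0 := NeZero.ne _
  push_cast
  field_simp

/-- The character `a ↦ ω^a` of `ℤ_{2N}`. -/
noncomputable def omegaPow {N : ℕ} (a : ZMod (2 * N)) : ℂ := ((xpOmega N ^ a.val : ℂˣ) : ℂ)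

theorem omegaPow_natCast [NeZero N] (k : ℕ) :
    omegaPow (k : ZMod (2 * N)) = ((xpOmega N ^ k : ℂˣ) : ℂ) := by
  rw [omegaPow, ZMod.val_natCast, (isPrimitiveRoot_xpOmega N).eq_orderOf, pow_mod_orderOf]

theorem omegaPow_add [NeZero N] (a b : ZMod (2 * N)) :
    omegaPow (a + b) = omegaPow a * omegaPow b := by
  rw [← ZMod.natCast_zmod_val a, ← ZMod.natCast_zmod_val b, ← Nat.cast_add, omegaPow_natCast,
    omegaPow_natCast, omegaPow_natCast, pow_add, Units.val_mul]

theorem omegaPow_zero : omegaPow (0 : ZMod (2 * N)) = 1 := by simp [omegaPow]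

theorem omegaPow_ne_zero (a : ZMod (2 * N)) : omegaPow a ≠ 0 := Units.ne_zero _

theorem omegaPow_injective [NeZero N] : Function.Injective (omegaPow (N := N)) := fun a b h =>
  ZMod.val_injective _ ((isPrimitiveRoot_xpOmega N).pow_inj a.val_lt b.val_lt (Units.ext h))

theorem omegaPow_sum [NeZero N] {ι : Type*} (s : Finset ι) (f : ι → ZMod (2 * N)) :
    omegaPow (∑ i ∈ s, f i) = ∏ i ∈ s, omegaPow (f i) := by
  classical
  induction s using Finset.induction_on with
  | empty => simp [omegaPow_zero]
  | insert a s ha ih => rw [Finset.sum_insert ha, Finset.prod_insert ha, omegaPow_add, ih]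

/-- The bit `b` as an element `0` or `1` of a ring. -/
def bitCast {R : Type*} [Zero R] [One R] (b : ZMod 2) : R := if b = 0 then 0 else 1

end PhaseArithmetic

/-! ### XP operators as monomial matrices -/

section Entries

variable {N n : ℕ} [NeZero N]

omit [NeZero N] in
theorem coe_phaseP_pow (k : ℕ) :
    ((phaseP N ^ k : Matrix.GeneralLinearGroup (Fin 2) ℂ) : Matrix (Fin 2) (Fin 2) ℂ) =
      !![1, 0; 0, ((xpOmega N ^ (2 * k) : ℂˣ) : ℂ)] := by
  induction k with
  | zero => simp [Matrix.one_fin_two]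
  | succ k ih =>
    rw [pow_succ, Units.val_mul, ih]
    have : (phaseP N : Matrix (Fin 2) (Fin 2) ℂ) = !![1, 0; 0, ((xpOmega N ^ 2 : ℂˣ) : ℂ)] := rfl
    rw [this, Matrix.mul_fin_two]
    simp [mul_add, pow_add]

/-- The indices are taken in `ZMod 2`, definitionally `Fin 2`, so that the bit flip by X becomes
addition. -/
theorem pauliX_pow_mul_phaseP_pow_apply (x : ZMod 2) (z : ZMod N) (a b : ZMod 2) :
    ((pauliX ^ x.val * phaseP N ^ z.val : Matrix.GeneralLinearGroup (Fin 2) ℂ) :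
      Matrix (Fin 2) (Fin 2) ℂ) a b =
      if a = b + x then omegaPow (doubleHom N z * bitCast b) else 0 := by
  have hd : omegaPow (doubleHom N z) = ((xpOmega N ^ (2 * z.val) : ℂˣ) : ℂ) :=
    omegaPow_natCast (N := N) (2 * z.val)
  have e0 : omegaPow (doubleHom N z * bitCast 0) = 1 := by simp [bitCast, omegaPow_zero]
  have e1 : omegaPow (doubleHom N z * bitCast 1) = omegaPow (doubleHom N z) := by simp [bitCast]
  have two : ∀ P : ZMod 2 → Prop, P 0 → P 1 → ∀ y, P y := by
    intro P p0 p1 y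
    by_cases hy : y = 0
    · rwa [hy]
    · rwa [ZMod.two_eq_one_of_ne_zero hy]
  rw [Units.val_mul, coe_phaseP_pow, ← hd]
  generalize omegaPow (doubleHom N z) = w at e1
  revert x
  refine two _ ?_ ?_
  · have hM : ((pauliX ^ (0 : ZMod 2).val : Matrix.GeneralLinearGroup (Fin 2) ℂ) :
        Matrix (Fin 2) (Fin 2) ℂ) * !![1, 0; 0, w] = !![1, 0; 0, w] := by
      rw [ZMod.val_zero, pow_zero, Units.val_one, one_mul]
    rw [hM]
    revert a b
    refine two _ (two _ ?_ ?_) (two _ ?_ ?_)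
    · rw [if_pos (by decide), e0]; rfl
    · rw [if_neg (by decide)]; rfl
    · rw [if_neg (by decide)]; rfl
    · rw [if_pos (by decide), e1]; rfl
  · have hM : ((pauliX ^ (1 : ZMod 2).val : Matrix.GeneralLinearGroup (Fin 2) ℂ) :
        Matrix (Fin 2) (Fin 2) ℂ) * !![1, 0; 0, w] = !![0, w; 1, 0] := by
      have hX : (pauliX : Matrix (Fin 2) (Fin 2) ℂ) = !![0, 1; 1, 0] := rfl
      rw [ZMod.val_one, pow_one, hX, Matrix.mul_fin_two]
      simp
    rw [hM]
    revert a b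
    refine two _ (two _ ?_ ?_) (two _ ?_ ?_)
    · rw [if_neg (by decide)]; rfl
    · rw [if_pos (by decide), e1]; rfl
    · rw [if_pos (by decide), e0]; rfl
    · rw [if_neg (by decide)]; rfl

/-- The exponent of `ω` in the column `f` of an XP operator. -/
def XPVector.phase (u : XPVector N n) (f : Fin n → ZMod 2) : ZMod (2 * N) :=
  u.p + ∑ i, doubleHom N (u.z i) * bitCast (f i)

theorem XPVector.toOp_apply (u : XPVector N n) (e f : Fin n → ZMod 2) :
    (u.toOp : Matrix (Fin n → Fin 2) (Fin n → Fin 2) ℂ) e f =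
      if e = f + u.x then omegaPow (u.phase f) else 0 := by
  have h1 : (u.toOp : Matrix (Fin n → Fin 2) (Fin n → Fin 2) ℂ) e f =
      omegaPow u.p * ∏ i, ((pauliX ^ (u.x i).val * phaseP N ^ (u.z i).val :
        Matrix.GeneralLinearGroup (Fin 2) ℂ) : Matrix (Fin 2) (Fin 2) ℂ) (e i) (f i) := by
    rfl
  rw [h1]
  have h2 : ∀ i, ((pauliX ^ (u.x i).val * phaseP N ^ (u.z i).val :
        Matrix.GeneralLinearGroup (Fin 2) ℂ) : Matrix (Fin 2) (Fin 2) ℂ) (e i) (f i) =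
      if e i = f i + u.x i then omegaPow (doubleHom N (u.z i) * bitCast (f i)) else 0 :=
    fun i => pauliX_pow_mul_phaseP_pow_apply (u.x i) (u.z i) (e i) (f i)
  rw [Finset.prod_congr rfl fun i _ => h2 i, Finset.prod_ite_zero, XPVector.phase, omegaPow_add,
    omegaPow_sum]
  simp only [Finset.mem_univ, forall_true_left, funext_iff, Pi.add_apply, mul_ite, mul_zero]

theorem XPVector.toOp_apply_ne_zero_iff (u : XPVector N n) (e f : Fin n → ZMod 2) :
    (u.toOp : Matrix (Fin n → Fin 2) (Fin n → Fin 2) ℂ) e f ≠ 0 ↔ e = f + u.x := by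
  rw [u.toOp_apply]
  split_ifs with h <;> simp [h, omegaPow_ne_zero]

theorem XPVector.isDiag_toOp_iff (u : XPVector N n) :
    (u.toOp : Matrix (Fin n → Fin 2) (Fin n → Fin 2) ℂ).IsDiag ↔ u.x = 0 := by
  constructor
  · intro h
    by_contra hne
    exact (u.toOp_apply_ne_zero_iff (0 + u.x) 0).2 rfl (h fun h' => hne (by
      rw [← zero_add u.x]; exact h'))
  · intro hx e f hef
    by_contra h
    refine hef (((u.toOp_apply_ne_zero_iff e f).1 h).trans ?_)
    rw [hx]
    exact add_zero (f : Fin n → ZMod 2)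

/-- The support gives `x`. The phase of column 0 is `p`, and the phase of the i-th unit vector
exceeds it by 2zᵢ, which determines zᵢ because doubling ℤ_N → ℤ_{2N} is injective. -/
theorem XPVector.toOp_injective :
    Function.Injective (XPVector.toOp : XPVector N n → QubitOp n) := by
  intro u v h
  have hm : ∀ e f : Fin n → ZMod 2, (u.toOp : Matrix (Fin n → Fin 2) (Fin n → Fin 2) ℂ) e f =
      (v.toOp : Matrix (Fin n → Fin 2) (Fin n → Fin 2) ℂ) e f := fun e f => by rw [h]
  have hx : u.x = v.x := by
    have := (u.toOp_apply_ne_zero_iff (0 + u.x) 0).2 rfl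
    rw [hm, v.toOp_apply_ne_zero_iff] at this
    simpa using this
  have hphase : ∀ f, u.phase f = v.phase f := fun f => by
    have := hm (f + u.x) f
    rw [u.toOp_apply, v.toOp_apply, if_pos rfl, if_pos (by rw [hx])] at this
    exact omegaPow_injective this
  have hp : u.p = v.p := by
    simpa [XPVector.phase, bitCast] using hphase 0
  have hz : u.z = v.z := by
    funext i
    have := hphase (Pi.single i 1)
    rw [XPVector.phase, XPVector.phase, hp, add_right_inj] at this
    have key : ∀ w : XPVector N n, ∑ j, doubleHom N (w.z j) *
        bitCast ((Pi.single i 1 : Fin n → ZMod 2) j) = doubleHom N (w.z i) := fun w => by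
      rw [Finset.sum_eq_single i]
      · simp [bitCast]
      · intro j _ hj
        simp [bitCast, hj]
      · simp
    rw [key, key] at this
    exact doubleHom_injective this
  cases u; cases v
  simp_all

end Entries

/-! ### The group of XP vectors -/

section GroupStructure

variable {N n : ℕ} [NeZero N]

instance : One (XPVector N n) := ⟨⟨0, 0, 0⟩⟩

/-- The formula comes from P^z X = ω^{2z} X P^{-z}: each Z exponent passing an X changes sign and
leaves a phase. -/
instance : Mul (XPVector N n) :=
  ⟨fun u v => ⟨u.p + v.p + ∑ i, doubleHom N (u.z i) * bitCast (v.x i), u.x + v.x,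
    fun i => (if v.x i = 0 then u.z i else -u.z i) + v.z i⟩⟩

instance : Inv (XPVector N n) :=
  ⟨fun u => ⟨-u.p - ∑ i, doubleHom N (if u.x i = 0 then -u.z i else u.z i) * bitCast (u.x i), -u.x,
    fun i => if u.x i = 0 then -u.z i else u.z i⟩⟩

omit [NeZero N] in
theorem XPVector.ext' {u v : XPVector N n} (hp : u.p = v.p) (hx : u.x = v.x) (hz : u.z = v.z) :
    u = v := by
  cases u; cases v; simp_all

theorem XPVector.x_mul (u v : XPVector N n) : (u * v).x = u.x + v.x := rfl

theorem XPVector.p_mul (u v : XPVector N n) :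
    (u * v).p = u.p + v.p + ∑ i, doubleHom N (u.z i) * bitCast (v.x i) := rfl

theorem XPVector.z_mul (u v : XPVector N n) (i : Fin n) :
    (u * v).z i = (if v.x i = 0 then u.z i else -u.z i) + v.z i := rfl

/-- The right factor acts first and sends `f` to `f + v.x`, which is where the left factor picks up
its phase. -/
theorem XPVector.phase_mul (u v : XPVector N n) (f : Fin n → ZMod 2) :
    (u * v).phase f = u.phase (f + v.x) + v.phase f := by
  simp only [XPVector.phase, XPVector.p_mul, XPVector.z_mul]
  have key : ∀ i, doubleHom N ((if v.x i = 0 then u.z i else -u.z i) + v.z i) * bitCast (f i) +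
      doubleHom N (u.z i) * bitCast (v.x i) =
      doubleHom N (u.z i) * bitCast ((f + v.x) i) + doubleHom N (v.z i) * bitCast (f i) := by
    intro i
    rw [Pi.add_apply, map_add, add_mul]
    generalize v.x i = a
    generalize f i = b
    by_cases ha : a = 0
    · subst ha; simp [bitCast, add_comm]
    · rw [ZMod.two_eq_one_of_ne_zero ha]
      by_cases hb : b = 0
      · subst hb; simp [bitCast]
      · rw [ZMod.two_eq_one_of_ne_zero hb]
        have : (1 + 1 : ZMod 2) = 0 := rfl
        simp [bitCast, this]
  have hs := Finset.sum_congr (rfl : (Finset.univ : Finset (Fin n)) = _) fun i _ => key i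
  rw [Finset.sum_add_distrib, Finset.sum_add_distrib] at hs
  linear_combination hs

theorem XPVector.toOp_mul (u v : XPVector N n) : (u * v).toOp = u.toOp * v.toOp := by
  refine Units.ext (Matrix.ext fun (e f : Fin n → ZMod 2) => ?_)
  have hsum := Finset.sum_eq_single (s := Finset.univ) (M := ℂ)
    (f := fun k : Fin n → ZMod 2 => (u.toOp : Matrix (Fin n → Fin 2) (Fin n → Fin 2) ℂ) e k *
      (v.toOp : Matrix (Fin n → Fin 2) (Fin n → Fin 2) ℂ) k f) (f + v.x)
    (fun k _ hk => by
      by_contra h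
      exact hk ((v.toOp_apply_ne_zero_iff k f).1 (right_ne_zero_of_mul h)))
    (fun h => absurd (Finset.mem_univ _) h)
  refine Eq.trans ?_ ((Matrix.mul_apply (M := (u.toOp : Matrix (Fin n → Fin 2) (Fin n → Fin 2) ℂ))
    (N := (v.toOp : Matrix (Fin n → Fin 2) (Fin n → Fin 2) ℂ)) (i := e) (k := f)).trans hsum).symm
  rw [(u * v).toOp_apply, u.toOp_apply, v.toOp_apply, if_pos rfl, XPVector.phase_mul,
    omegaPow_add, ite_mul, zero_mul, XPVector.x_mul, add_assoc, add_comm v.x]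

theorem XPVector.toOp_one : (1 : XPVector N n).toOp = 1 := by
  refine Units.ext (Matrix.ext fun (e f : Fin n → ZMod 2) => ?_)
  rw [XPVector.toOp_apply]
  have hx : (1 : XPVector N n).x = 0 := rfl
  have hph : (1 : XPVector N n).phase f = 0 := by
    have hz : (1 : XPVector N n).z = 0 := rfl
    have hp : (1 : XPVector N n).p = 0 := rfl
    simp [XPVector.phase, hz, hp]
  rw [hx, hph, omegaPow_zero, add_zero]
  exact (Matrix.one_apply (n := Fin n → Fin 2) (i := e) (j := f)).symm

theorem XPVector.inv_mul_cancel' (u : XPVector N n) : u⁻¹ * u = 1 := by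
  refine XPVector.ext' ?_ (neg_add_cancel u.x) (funext fun i => ?_)
  · rw [XPVector.p_mul]
    change -u.p - _ + u.p + _ = 0
    rw [sub_add_eq_add_sub, neg_add_cancel, zero_sub]
    exact neg_add_cancel _
  · rw [XPVector.z_mul]
    change (if u.x i = 0 then (if u.x i = 0 then -u.z i else u.z i)
      else -(if u.x i = 0 then -u.z i else u.z i)) + u.z i = 0
    split_ifs <;> simp

/-- Associativity and the unit law are pulled back from matrices along the injective `toOp`. -/
noncomputable instance : Group (XPVector N n) :=
  Group.ofLeftAxioms
    (fun u v w => XPVector.toOp_injective (by simp only [XPVector.toOp_mul, mul_assoc]))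
    (fun u => XPVector.toOp_injective (by rw [XPVector.toOp_mul, XPVector.toOp_one, one_mul]))
    XPVector.inv_mul_cancel'

/-- The inclusion of XP operators into all operators. -/
noncomputable def XPVector.toOpHom (N n : ℕ) [NeZero N] : XPVector N n →* QubitOp n where
  toFun := XPVector.toOp
  map_one' := XPVector.toOp_one
  map_mul' := XPVector.toOp_mul

/-- The X component, as a homomorphism. -/
noncomputable def XPVector.xHom (N n : ℕ) [NeZero N] :
    XPVector N n →* Multiplicative (Fin n → ZMod 2) where
  toFun u := Multiplicative.ofAdd u.x
  map_one' := rfl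
  map_mul' _ _ := rfl

theorem XPVector.x_inv (u : XPVector N n) : (u⁻¹).x = -u.x := map_inv (XPVector.xHom N n) u

theorem XPVector.x_pow (u : XPVector N n) (k : ℕ) : (u ^ k).x = k • u.x :=
  map_pow (XPVector.xHom N n) u k

theorem XPVector.Zp_castSucc (u : XPVector N n) (i : Fin n) :
    u.Zp i.castSucc = doubleHom N (u.z i) := by
  rw [XPVector.Zp, Fin.snoc_castSucc]; rfl

omit [NeZero N] in
theorem XPVector.Zp_last (u : XPVector N n) : u.Zp (Fin.last n) = u.p := by
  rw [XPVector.Zp, Fin.snoc_last]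

theorem XPVector.eq_of_x_of_Zp {u v : XPVector N n} (hx : u.x = v.x) (h : u.Zp = v.Zp) :
    u = v := by
  refine XPVector.ext' ?_ hx (funext fun i => doubleHom_injective ?_)
  · rw [← u.Zp_last, h, v.Zp_last]
  · rw [← u.Zp_castSucc, h, v.Zp_castSucc]

/-- Multiplying by a diagonal operator on the right adds the vectors `(2z | p)`. -/
theorem XPVector.Zp_mul (u : XPVector N n) {v : XPVector N n} (hv : v.x = 0) :
    (u * v).Zp = u.Zp + v.Zp := by
  funext j
  refine Fin.lastCases ?_ (fun i => ?_) j
  · simp [XPVector.Zp_last, XPVector.p_mul, hv, bitCast]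
  · simp [XPVector.Zp_castSucc, XPVector.z_mul, hv]

theorem XPVector.Zp_one : (1 : XPVector N n).Zp = 0 := by
  have := XPVector.Zp_mul (1 : XPVector N n) (v := 1) rfl
  rw [mul_one] at this
  exact left_eq_add.1 this

theorem XPVector.Zp_inv {u : XPVector N n} (hu : u.x = 0) : (u⁻¹).Zp = -u.Zp := by
  rw [eq_neg_iff_add_eq_zero, ← XPVector.Zp_mul _ hu, inv_mul_cancel, XPVector.Zp_one]

theorem XPVector.Zp_pow {u : XPVector N n} (hu : u.x = 0) (k : ℕ) : (u ^ k).Zp = k • u.Zp := by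
  induction k with
  | zero => simp [XPVector.Zp_one]
  | succ k ih => rw [pow_succ, XPVector.Zp_mul _ hu, ih, succ_nsmul]

end GroupStructure

/-! ### Generator products as linear combinations -/

section GeneratorProducts

theorem generatorProduct_map {Γ Δ : Type*} [Group Γ] [Group Δ] (f : Γ →* Δ) (S : List Γ)
    (a : Fin S.length → ℤ) :
    generatorProduct (S.map f) (fun i => a (Fin.cast (List.length_map f) i)) =
      f (generatorProduct S a) := by
  rw [generatorProduct, generatorProduct, map_list_prod]
  refine congrArg List.prod (List.ext_getElem (by simp) fun i h₁ h₂ => ?_)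
  simp

theorem generatorProduct_mem {Γ : Type*} [Group Γ] {K : Subgroup Γ} {S : List Γ}
    (hS : ∀ g ∈ S, g ∈ K) (a : Fin S.length → ℤ) : generatorProduct S a ∈ K := by
  refine Subgroup.list_prod_mem _ fun g hg => ?_
  obtain ⟨i, rfl⟩ := (List.mem_ofFn' _ _).1 hg
  exact K.zpow_mem (hS _ (List.get_mem S i)) _

variable {N n : ℕ} [NeZero N]

theorem XPVector.x_list_prod (l : List (XPVector N n)) :
    l.prod.x = (l.map XPVector.x).sum := by
  induction l with
  | nil => rfl
  | cons u l ih => rw [List.prod_cons, XPVector.x_mul, ih, List.map_cons, List.sum_cons]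

theorem XPVector.x_list_prod_eq_zero {l : List (XPVector N n)} (hl : ∀ u ∈ l, u.x = 0) :
    l.prod.x = 0 := by
  rw [XPVector.x_list_prod]
  refine List.sum_eq_zero fun v hv => ?_
  obtain ⟨u, hu, rfl⟩ := List.mem_map.1 hv
  exact hl u hu

theorem XPVector.Zp_list_prod {l : List (XPVector N n)} (hl : ∀ u ∈ l, u.x = 0) :
    l.prod.Zp = (l.map XPVector.Zp).sum := by
  induction l with
  | nil => exact XPVector.Zp_one
  | cons u l ih =>
    have hl' : ∀ v ∈ l, v.x = 0 := fun v hv => hl v (List.mem_cons_of_mem _ hv)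
    rw [List.prod_cons, XPVector.Zp_mul _ (XPVector.x_list_prod_eq_zero hl'), ih hl',
      List.map_cons, List.sum_cons]

theorem XPVector.x_generatorProduct (A : List (XPVector N n)) (a : Fin A.length → ZMod 2) :
    (generatorProduct A fun i => ((a i).val : ℤ)).x = ∑ i, a i • (xMatrix A).row i := by
  rw [generatorProduct, XPVector.x_list_prod, List.map_ofFn, List.sum_ofFn]
  refine Finset.sum_congr rfl fun i _ => ?_
  simp only [Function.comp_apply, zpow_natCast]
  rw [XPVector.x_pow, ← Nat.cast_smul_eq_nsmul (ZMod 2), ZMod.natCast_zmod_val]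
  rfl

theorem XPVector.x_generatorProduct_eq_zero {B : List (XPVector N n)} (hB : ∀ u ∈ B, u.x = 0)
    (b : Fin B.length → ZMod (2 * N)) :
    (generatorProduct B fun i => ((b i).val : ℤ)).x = 0 := by
  refine XPVector.x_list_prod_eq_zero fun u hu => ?_
  obtain ⟨i, rfl⟩ := (List.mem_ofFn' _ _).1 hu
  simp only [zpow_natCast]
  rw [XPVector.x_pow, hB _ (List.get_mem B i), smul_zero]

theorem XPVector.Zp_generatorProduct {B : List (XPVector N n)} (hB : ∀ u ∈ B, u.x = 0)
    (b : Fin B.length → ZMod (2 * N)) :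
    (generatorProduct B fun i => ((b i).val : ℤ)).Zp = ∑ i, b i • (zpMatrix B).row i := by
  rw [generatorProduct, XPVector.Zp_list_prod, List.map_ofFn, List.sum_ofFn]
  · refine Finset.sum_congr rfl fun i _ => ?_
    simp only [Function.comp_apply, zpow_natCast]
    rw [XPVector.Zp_pow (hB _ (List.get_mem B i)), ← Nat.cast_smul_eq_nsmul (ZMod (2 * N)),
      ZMod.natCast_zmod_val]
    rfl
  · intro u hu
    obtain ⟨i, rfl⟩ := (List.mem_ofFn' _ _).1 hu
    simp only [zpow_natCast]
    rw [XPVector.x_pow, hB _ (List.get_mem B i), smul_zero]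

end GeneratorProducts

/-! ### Canonical generators of a group of vectors -/

section CanonicalPairs

variable {N n : ℕ} [NeZero N]

/-- The vectors `(2z | p)` of the diagonal operators in a group of XP operators. -/
def diagonalLattice (Γ : Subgroup (XPVector N n)) :
    Submodule (ZMod (2 * N)) (Fin (n + 1) → ZMod (2 * N)) where
  carrier := {v | ∃ u ∈ Γ, u.x = 0 ∧ u.Zp = v}
  zero_mem' := ⟨1, Γ.one_mem, rfl, XPVector.Zp_one⟩
  add_mem' := by
    rintro _ _ ⟨u, hu, hux, rfl⟩ ⟨v, hv, hvx, rfl⟩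
    exact ⟨u * v, Γ.mul_mem hu hv, by rw [XPVector.x_mul, hux, hvx, add_zero],
      XPVector.Zp_mul u hvx⟩
  smul_mem' := by
    rintro c _ ⟨u, hu, hux, rfl⟩
    refine ⟨u ^ c.val, Γ.pow_mem hu _, by rw [XPVector.x_pow, hux, smul_zero], ?_⟩
    rw [XPVector.Zp_pow hux, ← Nat.cast_smul_eq_nsmul (ZMod (2 * N)), ZMod.natCast_zmod_val]

/-- The X components of the operators in a group of XP operators. -/
def xSpace (Γ : Subgroup (XPVector N n)) : Submodule (ZMod 2) (Fin n → ZMod 2) where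
  carrier := {v | ∃ u ∈ Γ, u.x = v}
  zero_mem' := ⟨1, Γ.one_mem, rfl⟩
  add_mem' := by
    rintro _ _ ⟨u, hu, rfl⟩ ⟨v, hv, rfl⟩
    exact ⟨u * v, Γ.mul_mem hu hv, rfl⟩
  smul_mem' := by
    rintro c _ ⟨u, hu, rfl⟩
    refine ⟨u ^ c.val, Γ.pow_mem hu _, ?_⟩
    rw [XPVector.x_pow, ← Nat.cast_smul_eq_nsmul (ZMod 2), ZMod.natCast_zmod_val]

/-- The operators of a group are generator products of any two lists whose X components and
vectors `(2z | p)` span those of the group. -/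
theorem exists_generatorProduct_of_span {Γ : Subgroup (XPVector N n)} {A B : List (XPVector N n)}
    (hA : ∀ u ∈ A, u ∈ Γ) (hB : ∀ u ∈ B, u.x = 0)
    (hx : xSpace Γ ≤ Submodule.span (ZMod 2) (Set.range (xMatrix A).row))
    (hz : diagonalLattice Γ ≤ Submodule.span (ZMod (2 * N)) (Set.range (zpMatrix B).row))
    {g : XPVector N n} (hg : g ∈ Γ) :
    ∃ (a : Fin A.length → ZMod 2) (b : Fin B.length → ZMod (2 * N)),
      g = generatorProduct A (fun i => ((a i).val : ℤ)) *
        generatorProduct B (fun j => ((b j).val : ℤ)) := by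
  obtain ⟨a, ha⟩ := (Submodule.mem_span_range_iff_exists_fun _).1 (hx ⟨g, hg, rfl⟩)
  set s := generatorProduct A (fun i => ((a i).val : ℤ)) with hs
  have hsΓ : s ∈ Γ := generatorProduct_mem hA _
  have hsx : s.x = g.x := by rw [hs, XPVector.x_generatorProduct, ha]
  -- Once X components agree, the quotient is diagonal and falls to the rows of `B`.
  have hdx : (s⁻¹ * g).x = 0 := by rw [XPVector.x_mul, XPVector.x_inv, hsx, neg_add_cancel]
  obtain ⟨b, hb⟩ := (Submodule.mem_span_range_iff_exists_fun _).1
    (hz ⟨s⁻¹ * g, Γ.mul_mem (Γ.inv_mem hsΓ) hg, hdx, rfl⟩)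
  refine ⟨a, b, ?_⟩
  rw [← inv_mul_eq_iff_eq_mul]
  refine XPVector.eq_of_x_of_Zp ?_ ?_
  · rw [hdx, XPVector.x_generatorProduct_eq_zero hB]
  · rw [XPVector.Zp_generatorProduct hB, hb]

/-- Canonical generators of a group of XP operators, in terms of vectors. -/
structure IsCanonicalPair (Γ : Subgroup (XPVector N n)) (A B : List (XPVector N n)) : Prop where
  form : IsCanonicalForm A B
  generates : Subgroup.closure ({u | u ∈ A} ∪ {u | u ∈ B}) = Γ
  generates_diagonal : ∀ u, u ∈ Subgroup.closure {v | v ∈ B} ↔ u ∈ Γ ∧ u.x = 0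

namespace IsCanonicalPair

variable {Γ : Subgroup (XPVector N n)} {A B : List (XPVector N n)}

theorem left_mem (h : IsCanonicalPair Γ A B) {u : XPVector N n} (hu : u ∈ A) : u ∈ Γ :=
  h.generates ▸ Subgroup.subset_closure (Or.inl hu)

theorem right_mem (h : IsCanonicalPair Γ A B) {u : XPVector N n} (hu : u ∈ B) : u ∈ Γ :=
  h.generates ▸ Subgroup.subset_closure (Or.inr hu)

/-- Joint generation would not suffice, as squares and commutators of non-diagonal operators are
diagonal too; what counts is that `B` alone generates every diagonal operator of `Γ`. -/
theorem span_zpMatrix (h : IsCanonicalPair Γ A B) :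
    Submodule.span (ZMod (2 * N)) (Set.range (zpMatrix B).row) = diagonalLattice Γ := by
  refine le_antisymm (Submodule.span_le.2 ?_) ?_
  · rintro _ ⟨i, rfl⟩
    exact ⟨_, h.right_mem (List.get_mem B i), h.form.diagonal _ (List.get_mem B i), rfl⟩
  · rintro _ ⟨u, hu, hux, rfl⟩
    have key : u.x = 0 ∧ u.Zp ∈ Submodule.span (ZMod (2 * N)) (Set.range (zpMatrix B).row) := by
      refine Subgroup.closure_induction ?_ ?_ ?_ ?_ ((h.generates_diagonal u).2 ⟨hu, hux⟩)
      · intro v hv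
        obtain ⟨i, rfl⟩ := List.get_of_mem hv
        exact ⟨h.form.diagonal _ hv, Submodule.subset_span ⟨i, rfl⟩⟩
      · exact ⟨rfl, by rw [XPVector.Zp_one]; exact zero_mem _⟩
      · rintro v w _ _ ⟨hv, hv'⟩ ⟨hw, hw'⟩
        exact ⟨by rw [XPVector.x_mul, hv, hw, add_zero],
          by rw [XPVector.Zp_mul _ hw]; exact add_mem hv' hw'⟩
      · rintro v _ ⟨hv, hv'⟩
        exact ⟨by rw [XPVector.x_inv, hv, neg_zero],
          by rw [XPVector.Zp_inv hv]; exact neg_mem hv'⟩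
    exact key.2

theorem span_xMatrix (h : IsCanonicalPair Γ A B) :
    Submodule.span (ZMod 2) (Set.range (xMatrix A).row) = xSpace Γ := by
  refine le_antisymm (Submodule.span_le.2 ?_) ?_
  · rintro _ ⟨i, rfl⟩
    exact ⟨_, h.left_mem (List.get_mem A i), rfl⟩
  · rintro _ ⟨u, hu, rfl⟩
    rw [← h.generates] at hu
    refine Subgroup.closure_induction
      (p := fun v _ => v.x ∈ Submodule.span (ZMod 2) (Set.range (xMatrix A).row)) ?_ ?_ ?_ ?_ hu
    · rintro v (hv | hv)
      · obtain ⟨i, rfl⟩ := List.get_of_mem hv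
        exact Submodule.subset_span ⟨i, rfl⟩
      · rw [h.form.diagonal v hv]
        exact zero_mem _
    · exact zero_mem _
    · exact fun v w _ _ hv hw => add_mem hv hw
    · intro v _ hv
      rw [XPVector.x_inv]
      exact neg_mem hv

theorem exists_generatorProduct (h : IsCanonicalPair Γ A B) {g : XPVector N n} (hg : g ∈ Γ) :
    ∃ (a : Fin A.length → ZMod 2) (b : Fin B.length → ZMod (2 * N)),
      g = generatorProduct A (fun i => ((a i).val : ℤ)) *
        generatorProduct B (fun j => ((b j).val : ℤ)) :=
  exists_generatorProduct_of_span (fun _ hu => h.left_mem hu) h.form.diagonal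
    h.span_xMatrix.ge h.span_zpMatrix.ge hg

theorem isReducedMod (h : IsCanonicalPair Γ A B) {u : XPVector N n} (hu : u ∈ A) :
    IsReducedMod (diagonalLattice Γ) 0 u.Zp := by
  have : Fact (1 < 2 * N) := ⟨by have := NeZero.pos N; omega⟩
  rw [← h.span_zpMatrix]
  exact (isHowellForm_borderedMatrix_iff h.form.howell u.Zp).1 (h.form.reduced u hu)

theorem isHowellForm_xMatrix (h : IsCanonicalPair Γ A B) : IsHowellForm (xMatrix A) :=
  h.form.rref.isHowellForm fun i => h.form.nondiagonal _ (List.get_mem A i)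

theorem unique {A' B' : List (XPVector N n)} (h : IsCanonicalPair Γ A B)
    (h' : IsCanonicalPair Γ A' B') : A = A' ∧ B = B' := by
  constructor
  · obtain ⟨hl, hrow⟩ := h.isHowellForm_xMatrix.unique h'.isHowellForm_xMatrix
      (h.span_xMatrix.trans h'.span_xMatrix.symm)
    refine List.ext_get hl fun i h₁ h₂ => ?_
    have hx : (A.get ⟨i, h₁⟩).x = (A'.get ⟨i, h₂⟩).x := hrow ⟨i, h₁⟩
    set u := A.get ⟨i, h₁⟩
    set v := A'.get ⟨i, h₂⟩
    have hu : u ∈ A := List.get_mem A _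
    have hv : v ∈ A' := List.get_mem A' _
    have hdx : (v⁻¹ * u).x = 0 := by rw [XPVector.x_mul, XPVector.x_inv, hx, neg_add_cancel]
    have hzp : u.Zp = v.Zp + (v⁻¹ * u).Zp := by
      rw [← XPVector.Zp_mul _ hdx, mul_inv_cancel_left]
    -- With equal X components, `u` and `v` differ by a diagonal factor in `Γ`, so their vectors are
    -- reduced representatives of one coset of the lattice.
    refine XPVector.eq_of_x_of_Zp hx ((h.isReducedMod hu).eq_of_sub_mem (h'.isReducedMod hv)
      ⟨v⁻¹ * u, Γ.mul_mem (Γ.inv_mem (h'.left_mem hv)) (h.left_mem hu), hdx, ?_⟩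
      fun j hj => absurd hj (Nat.not_lt_zero _))
    rw [hzp, add_sub_cancel_left]
  · obtain ⟨hl, hrow⟩ := h.form.howell.unique h'.form.howell
      (h.span_zpMatrix.trans h'.span_zpMatrix.symm)
    refine List.ext_get hl fun i h₁ h₂ => XPVector.eq_of_x_of_Zp ?_ (hrow ⟨i, h₁⟩)
    rw [h.form.diagonal _ (List.get_mem B _), h'.form.diagonal _ (List.get_mem B' _)]

end IsCanonicalPair

theorem exists_list_of_forall_exists {α : Type*} {s : ℕ} {P : Fin s → α → Prop}
    (h : ∀ i, ∃ u, P i u) :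
    ∃ (A : List α) (hA : A.length = s), ∀ i, P (Fin.cast hA i) (A.get i) := by
  choose u hu using h
  exact ⟨List.ofFn u, List.length_ofFn, fun i => by rw [List.get_ofFn]; exact hu _⟩

theorem exists_isCanonicalPair (Γ : Subgroup (XPVector N n)) :
    ∃ A B : List (XPVector N n), IsCanonicalPair Γ A B := by
  have : Fact (1 < 2 * N) := ⟨by have := NeZero.pos N; omega⟩
  obtain ⟨s, H, hH, hspan⟩ := exists_isHowellForm (diagonalLattice Γ)
  obtain ⟨t, K, hK, hspanK⟩ := exists_isHowellForm (xSpace Γ)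
  have hex : ∀ i, ∃ u ∈ Γ, u.x = 0 ∧ u.Zp = H i := fun i =>
    hspan.le (Submodule.subset_span ⟨i, rfl⟩)
  obtain ⟨B, rfl, hB⟩ := exists_list_of_forall_exists hex
  have hexK : ∀ i, ∃ u ∈ Γ, u.x = K i ∧ IsReducedMod (diagonalLattice Γ) 0 u.Zp := by
    intro i
    obtain ⟨v, hv, hvx⟩ := hspanK.le (Submodule.subset_span ⟨i, rfl⟩)
    -- The correction that reduces `v.Zp` is itself the vector of a diagonal `d` in `Γ`, so `v * d`
    -- realizes the reduced vector.
    obtain ⟨w, ⟨d, hd, hdx, hdz⟩, -, hw⟩ := exists_isReducedMod (diagonalLattice Γ) 0 v.Zp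
    refine ⟨v * d, Γ.mul_mem hv hd, by rw [XPVector.x_mul, hdx, add_zero, hvx]; rfl, ?_⟩
    rwa [XPVector.Zp_mul _ hdx, hdz, add_sub_cancel]
  obtain ⟨A, rfl, hA⟩ := exists_list_of_forall_exists hexK
  obtain rfl : zpMatrix B = H := funext fun i => (hB i).2.2
  obtain rfl : xMatrix A = K := funext fun i => (hA i).2.1
  have hAΓ : ∀ u ∈ A, u ∈ Γ := fun u hu => by
    obtain ⟨i, rfl⟩ := List.get_of_mem hu
    exact (hA i).1
  have hBΓ : ∀ u ∈ B, u ∈ Γ ∧ u.x = 0 := fun u hu => by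
    obtain ⟨i, rfl⟩ := List.get_of_mem hu
    exact ⟨(hB i).1, (hB i).2.1⟩
  refine ⟨A, B, ⟨fun u hu => ?_, fun u hu => (hBΓ u hu).2, hK.isReducedRowEchelon, hH,
    fun u hu => ?_⟩, le_antisymm ?_ fun g hg => ?_, fun u => ⟨fun hu => ?_, fun hu => ?_⟩⟩
  · obtain ⟨i, rfl⟩ := List.get_of_mem hu
    exact hK.row_ne_zero i
  · obtain ⟨i, rfl⟩ := List.get_of_mem hu
    rw [isHowellForm_borderedMatrix_iff hH, hspan]
    exact (hA i).2.2
  · rw [Subgroup.closure_le]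
    rintro u (hu | hu)
    exacts [hAΓ u hu, (hBΓ u hu).1]
  · obtain ⟨a, b, rfl⟩ := exists_generatorProduct_of_span hAΓ (fun u hu => (hBΓ u hu).2)
      hspanK.ge hspan.ge hg
    exact mul_mem (generatorProduct_mem (fun u hu => Subgroup.subset_closure (Or.inl hu)) _)
      (generatorProduct_mem (fun u hu => Subgroup.subset_closure (Or.inr hu)) _)
  · have hle : Subgroup.closure {v | v ∈ B} ≤ Γ ⊓ (XPVector.xHom N n).ker := by
      rw [Subgroup.closure_le]
      exact fun v hv => ⟨(hBΓ v hv).1, (hBΓ v hv).2⟩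
    exact hle hu
  · obtain ⟨b, hb⟩ := (Submodule.mem_span_range_iff_exists_fun _).1
      (hspan.ge ⟨u, hu.1, hu.2, rfl⟩)
    have hBx : ∀ v ∈ B, v.x = 0 := fun v hv => (hBΓ v hv).2
    have : u = generatorProduct B (fun j => ((b j).val : ℤ)) :=
      XPVector.eq_of_x_of_Zp (by rw [hu.2, XPVector.x_generatorProduct_eq_zero hBx])
        (by rw [XPVector.Zp_generatorProduct hBx, hb])
    rw [this]
    exact generatorProduct_mem (fun v hv => Subgroup.subset_closure hv) _

end CanonicalPairs

/-! ### Transfer from vectors to operators -/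

section Operators

variable {N n : ℕ} [NeZero N]

/-- The group of XP operators generated by `G`, in terms of vectors. -/
noncomputable def vectorGroup (N : ℕ) [NeZero N] {n : ℕ} (G : Set (QubitOp n)) :
    Subgroup (XPVector N n) :=
  (Subgroup.closure G).comap (XPVector.toOpHom N n)

theorem map_vectorGroup {G : Set (QubitOp n)}
    (hG : G ⊆ Set.range (XPVector.toOp : XPVector N n → QubitOp n)) :
    (vectorGroup N G).map (XPVector.toOpHom N n) = Subgroup.closure G :=
  Subgroup.map_comap_eq_self ((Subgroup.closure_le _).2 hG)

theorem map_closure_setOf_mem (A : List (XPVector N n)) :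
    Subgroup.closure {g | g ∈ A.map XPVector.toOp} =
      (Subgroup.closure {u | u ∈ A}).map (XPVector.toOpHom N n) := by
  rw [MonoidHom.map_closure]
  congr 1
  ext g
  simp [XPVector.toOpHom]

theorem isCanonicalGenerators_map_iff {G : Set (QubitOp n)}
    (hG : G ⊆ Set.range (XPVector.toOp : XPVector N n → QubitOp n)) (A B : List (XPVector N n)) :
    IsCanonicalGenerators N G (A.map XPVector.toOp) (B.map XPVector.toOp) ↔
      IsCanonicalPair (vectorGroup N G) A B := by
  have hinj : Function.Injective (XPVector.toOpHom N n) := XPVector.toOp_injective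
  have hgen : Subgroup.closure ({g | g ∈ A.map XPVector.toOp} ∪ {g | g ∈ B.map XPVector.toOp}) =
      Subgroup.closure G ↔
      Subgroup.closure ({u | u ∈ A} ∪ {u | u ∈ B}) = vectorGroup N G := by
    rw [Subgroup.closure_union, Subgroup.closure_union, map_closure_setOf_mem,
      map_closure_setOf_mem, ← Subgroup.map_sup, ← map_vectorGroup hG,
      (Subgroup.map_injective hinj).eq_iff]
  have hmem : ∀ u : XPVector N n, u.toOp ∈ Subgroup.closure {g | g ∈ B.map XPVector.toOp} ↔
      u ∈ Subgroup.closure {v | v ∈ B} := fun u => by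
    rw [map_closure_setOf_mem]
    exact Subgroup.mem_map_iff_mem hinj
  constructor
  · rintro ⟨⟨A', B', hA, hB, hform⟩, hg, hd⟩
    obtain rfl := List.map_injective_iff.2 XPVector.toOp_injective hA
    obtain rfl := List.map_injective_iff.2 XPVector.toOp_injective hB
    refine ⟨hform, hgen.1 hg, fun u => ?_⟩
    rw [← hmem, hd, u.isDiag_toOp_iff]
    rfl
  · rintro ⟨hform, hg, hd⟩
    refine ⟨⟨A, B, rfl, rfl, hform⟩, hgen.2 hg, fun g => ?_⟩
    -- The diagonal condition ranges over all operators; those that are not XP operators lie in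
    -- neither group.
    by_cases hr : ∃ u : XPVector N n, u.toOp = g
    · obtain ⟨u, rfl⟩ := hr
      rw [hmem, hd, u.isDiag_toOp_iff]
      rfl
    · refine iff_of_false (fun h => hr ?_) (fun h => hr ?_)
      · rw [map_closure_setOf_mem] at h
        obtain ⟨u, -, hu⟩ := h
        exact ⟨u, hu⟩
      · have := h.1
        rw [← map_vectorGroup hG] at this
        obtain ⟨u, -, hu⟩ := this
        exact ⟨u, hu⟩

theorem IsCanonicalGenerators.exists_isCanonicalPair {G : Set (QubitOp n)}
    (hG : G ⊆ Set.range (XPVector.toOp : XPVector N n → QubitOp n)) {SX SZ : List (QubitOp n)}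
    (h : IsCanonicalGenerators N G SX SZ) :
    ∃ A B : List (XPVector N n), SX = A.map XPVector.toOp ∧ SZ = B.map XPVector.toOp ∧
      IsCanonicalPair (vectorGroup N G) A B := by
  obtain ⟨A, B, rfl, rfl, -⟩ := h.form
  exact ⟨A, B, rfl, rfl, (isCanonicalGenerators_map_iff hG A B).1 h⟩

theorem IsCanonicalGenerators.unique {G₁ G₂ : Set (QubitOp n)}
    (hG₁ : G₁ ⊆ Set.range (XPVector.toOp : XPVector N n → QubitOp n))
    (hG₂ : G₂ ⊆ Set.range (XPVector.toOp : XPVector N n → QubitOp n))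
    (hG : Subgroup.closure G₁ = Subgroup.closure G₂) {SX₁ SZ₁ SX₂ SZ₂ : List (QubitOp n)}
    (h₁ : IsCanonicalGenerators N G₁ SX₁ SZ₁) (h₂ : IsCanonicalGenerators N G₂ SX₂ SZ₂) :
    SX₁ = SX₂ ∧ SZ₁ = SZ₂ := by
  obtain ⟨A₁, B₁, rfl, rfl, hp₁⟩ := h₁.exists_isCanonicalPair hG₁
  obtain ⟨A₂, B₂, rfl, rfl, hp₂⟩ := h₂.exists_isCanonicalPair hG₂
  have hv : vectorGroup N G₁ = vectorGroup N G₂ := by rw [vectorGroup, hG, vectorGroup]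
  rw [hv] at hp₁
  obtain ⟨rfl, rfl⟩ := hp₁.unique hp₂
  exact ⟨rfl, rfl⟩

end Operators

theorem proposition3 (N n : ℕ) (hN : 2 ≤ N) :
    -- every set of XP operators has unique canonical generators
    (∀ G : Set (QubitOp n), G ⊆ Set.range (XPVector.toOp : XPVector N n → QubitOp n) →
      ∃! S : List (QubitOp n) × List (QubitOp n), IsCanonicalGenerators N G S.1 S.2) ∧
    -- every group element is a generator product
    (∀ G : Set (QubitOp n), G ⊆ Set.range (XPVector.toOp : XPVector N n → QubitOp n) →
      ∀ SX SZ : List (QubitOp n), IsCanonicalGenerators N G SX SZ →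
        ∀ g ∈ Subgroup.closure G,
          ∃ (a : Fin SX.length → ZMod 2) (b : Fin SZ.length → ZMod (2 * N)),
            g = generatorProduct SX (fun i => ((a i).val : ℤ)) *
              generatorProduct SZ (fun j => ((b j).val : ℤ))) ∧
    -- two sets generate the same group iff they have the same canonical generators
    (∀ G₁ G₂ : Set (QubitOp n),
      G₁ ⊆ Set.range (XPVector.toOp : XPVector N n → QubitOp n) →
      G₂ ⊆ Set.range (XPVector.toOp : XPVector N n → QubitOp n) →
      ∀ SX₁ SZ₁ SX₂ SZ₂ : List (QubitOp n),
        IsCanonicalGenerators N G₁ SX₁ SZ₁ → IsCanonicalGenerators N G₂ SX₂ SZ₂ →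
          (Subgroup.closure G₁ = Subgroup.closure G₂ ↔ SX₁ = SX₂ ∧ SZ₁ = SZ₂)) := by
  have : NeZero N := ⟨by omega⟩
  refine ⟨fun G hG => ?_, fun G hG SX SZ h g hg => ?_,
    fun G₁ G₂ hG₁ hG₂ SX₁ SZ₁ SX₂ SZ₂ h₁ h₂ => ⟨fun h => h₁.unique hG₁ hG₂ h h₂, ?_⟩⟩
  · obtain ⟨A, B, h⟩ := exists_isCanonicalPair (vectorGroup N G)
    have hgen := (isCanonicalGenerators_map_iff hG A B).2 h
    refine ⟨(A.map XPVector.toOp, B.map XPVector.toOp), hgen, fun S hS => ?_⟩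
    obtain ⟨h1, h2⟩ := hS.unique hG hG rfl hgen
    exact Prod.ext h1 h2
  · obtain ⟨A, B, rfl, rfl, hp⟩ := h.exists_isCanonicalPair hG
    rw [← map_vectorGroup hG] at hg
    obtain ⟨u, hu, rfl⟩ := hg
    obtain ⟨a, b, hab⟩ := hp.exists_generatorProduct hu
    refine ⟨fun i => a (Fin.cast (List.length_map _) i),
      fun j => b (Fin.cast (List.length_map _) j), ?_⟩
    rw [hab, map_mul]
    exact congrArg₂ (· * ·)
      (generatorProduct_map (XPVector.toOpHom N n) A fun i => ((a i).val : ℤ)).symm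
      (generatorProduct_map (XPVector.toOpHom N n) B fun j => ((b j).val : ℤ)).symm
  · rintro ⟨rfl, rfl⟩
    exact h₁.generates.symm.trans h₂.generates
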